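/- Let $X=\{X(t),\,t\ge 0\}$ and $Z=\{Z(t),\,t\ge 0\}$ be real-valued stochastic processes (possibly on different probability spaces) and let $a:[0,\infty)\to\mathbb R$, $T\mapsto a_T$, be a measurable function with $a_T>0$ for $T>0$ and $a_T\to\infty$ as $T\to\infty$. Assume that for every $t>0$ the random variable $Z(t)$ is nondegenerate (not almost surely constant) and satisfies $P(Z(t)=0)=0$, and that $Z$ is continuous in probability at $t=0$. Suppose that $$\left\{\frac{X(Tt)}{a_T}\right\}_{t\ge 0}\longrightarrow \{Z(t)\}_{t\ge 0}\qquad\text{as } T\to\infty\ (T \text{ real})$$ in the sense of convergence of all finite-dimensional distributions. Then there exists $H>0$ such that for every $t>0$ $$\frac{\log|X(Tt)|}{\log T}\ \longrightarrow\ H\qquad\text{in probability, as } T\to\infty.$$ (The value given to $\log 0$ is immaterial, since $P(X(Tt)=0)\to0$ as $T\to\infty$; in the formal statement $\log 0=0$.) -/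

import Mathlib

open MeasureTheory ProbabilityTheory Filter Topology
open scoped NNReal

/-- Convergence of all finite-dimensional distributions: for every finite set `I` of times, the
random vectors `(Y T s)_{s ∈ I}` converge in distribution to `(Z s)_{s ∈ I}` along `l`.
(`TendstoInDistribution` contains the a.e. measurability of all these random vectors.) -/
def FddTendsto {ι S Ω Ω' : Type*} [MeasurableSpace Ω] [MeasurableSpace Ω']
    (Y : ι → S → Ω → ℝ) (l : Filter ι) (Z : S → Ω' → ℝ)
    (P : Measure Ω) [IsProbabilityMeasure P] (P' : Measure Ω') [IsProbabilityMeasure P'] : Prop :=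
  ∀ I : Finset S,
    TendstoInDistribution (fun (T : ι) (ω : Ω) (s : I) => Y T (s : S) ω) l
      (fun (ω : Ω') (s : I) => Z (s : S) ω) (fun _ => P) P'

/-- A random variable is nondegenerate if it is not almost surely equal to a constant. -/
def IsNondegenerate {Ω : Type*} [MeasurableSpace Ω] (ξ : Ω → ℝ) (P : Measure Ω) : Prop :=
  ¬ ∃ c : ℝ, ∀ᵐ ω ∂P, ξ ω = c

/-!
Put `h u = log a (exp u)`. Both `X (exp (u + x)) / a (exp (u + x))` and
`X (exp (u + x)) / a (exp u)` converge in distribution, to `Z 1` and `Z (exp x)`. Their moduli differ by the factor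
`exp (h (u + x) - h u)`, and neither limit has an atom at zero, so the increment `h (u + x) - h u`
converges as `u → ∞` (`exists_tendsto_log_scale`). No compactness is needed for this: the Laplace
transform of the modulus (`absLaplace`) is strictly decreasing and continuous, hence it determines
the scale and squeezes it to its limit.

The limits of the increments are additive and measurable in `x`, hence of the form `ρ * x`, and the
uniform convergence theorem for slowly varying functions gives `log (a T) / log T → ρ`
(`exists_forall_eq_mul_and_tendsto_div_self`).

The index is positive: `Z 0` has the law of the limit of `X 0 / a T`, which is zero
(`absLaplace_limit_zero`), while `|Z (exp x)|` has the law of `exp (ρ * x) |Z 1|`. If `ρ ≤ 0`, this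
stays away from zero as `x → -∞`, against continuity in probability of `Z` at zero.

Finally `log |X (T t)| = log (a T) + log |X (T t) / a T|`, and the last term is tight because
`X (T t) / a T` converges in distribution to `Z t`, which has no atom at zero. Division by `log T`
leaves `ρ` (`tendstoInMeasure_log_abs_div`).
-/

/-! ### Additively slowly and regularly varying functions -/

/-- Uniform convergence theorem for slowly varying functions, in additive form. The sets of bad
increments at `u` and at `u + x` both have measure below `1 / 2` for large `u`, so they cannot cover
`[1, 2]` together, and an intermediate point outside both links `u` to `u + x`. -/
lemma eventually_forall_abs_sub_lt_of_tendsto_zero {g : ℝ → ℝ} (hg : Measurable g)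
    (hlim : ∀ x, Tendsto (fun u => g (u + x) - g u) atTop (𝓝 0)) {ε : ℝ} (hε : 0 < ε) :
    ∀ᶠ u in atTop, ∀ x ∈ Set.Icc (0 : ℝ) 1, |g (u + x) - g u| < ε := by
  have key : Tendsto (fun u : ℝ => (volume.restrict (Set.Icc (0 : ℝ) 2))
      {y | ε / 2 ≤ ‖(g (u + y) - g u) - 0‖}) atTop (𝓝 0) := by
    refine tendsto_of_seq_tendsto fun w hw => ?_
    refine tendstoInMeasure_iff_norm.1 (tendstoInMeasure_of_tendsto_ae
      (f := fun n y => g (w n + y) - g (w n)) (g := fun _ => 0) (fun n => ?_) ?_)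
      (ε / 2) (half_pos hε)
    · exact Measurable.aestronglyMeasurable (by fun_prop)
    · exact ae_of_all _ fun y => (hlim y).comp hw
  have hev := key.eventually_lt_const (u := 1 / 2) (by simp)
  obtain ⟨U, hU⟩ := eventually_atTop.1 hev
  filter_upwards [eventually_ge_atTop U] with u hu x hx
  have hA := hU u hu
  have hB := hU (u + x) (by linarith [hx.1])
  have hmeas : ∀ v : ℝ, MeasurableSet {y | ε / 2 ≤ ‖(g (v + y) - g v) - 0‖} := fun v =>
    measurableSet_le measurable_const (by fun_prop)
  rw [Measure.restrict_apply (hmeas _)] at hA hB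
  set A := {y | ε / 2 ≤ ‖(g (u + y) - g u) - 0‖} ∩ Set.Icc (0 : ℝ) 2 with hA_def
  set B := {y | ε / 2 ≤ ‖(g (u + x + y) - g (u + x)) - 0‖} ∩ Set.Icc (0 : ℝ) 2 with hB_def
  have hnot : ¬ Set.Icc (1 : ℝ) 2 ⊆ A ∪ (fun y => y + -x) ⁻¹' B := by
    intro hsub
    have h1 : volume (Set.Icc (1 : ℝ) 2) ≤ volume A + volume B := by
      calc volume (Set.Icc (1 : ℝ) 2) ≤ volume (A ∪ (fun y => y + -x) ⁻¹' B) := measure_mono hsub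
        _ ≤ volume A + volume ((fun y => y + -x) ⁻¹' B) := measure_union_le _ _
        _ = volume A + volume B := by rw [measure_preimage_add_right]
    have h2 : volume A + volume B < 1 / 2 + 1 / 2 := ENNReal.add_lt_add hA hB
    rw [ENNReal.add_halves, Real.volume_Icc] at *
    norm_num at h1
    exact absurd h2 (not_lt.2 h1)
  obtain ⟨y, hy, hyn⟩ := Set.not_subset.1 hnot
  simp only [Set.mem_union, not_or, hA_def, hB_def, Set.mem_preimage, Set.mem_inter_iff,
    Set.mem_ofPred_eq, sub_zero, Real.norm_eq_abs, not_and', not_le] at hyn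
  have h1 := hyn.1 ⟨by linarith [hy.1], hy.2⟩
  have h2 := hyn.2 ⟨by linarith [hy.1, hx.2], by linarith [hy.2, hx.1]⟩
  rw [show u + x + (y + -x) = u + y by ring] at h2
  rw [abs_lt] at *
  constructor <;> linarith [h1.1, h1.2, h2.1, h2.2]

/-- A function whose increments over fixed distances vanish at infinity grows sublinearly: this
holds along the integers by Cesàro averaging of the unit increments, and in between by uniformity. -/
lemma tendsto_div_self_zero_of_tendsto_increments_zero {g : ℝ → ℝ} (hg : Measurable g)
    (hlim : ∀ x, Tendsto (fun u => g (u + x) - g u) atTop (𝓝 0)) :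
    Tendsto (fun u => g u / u) atTop (𝓝 0) := by
  have hces : Tendsto (fun n : ℕ => (n : ℝ)⁻¹ * (g n - g 0)) atTop (𝓝 0) := by
    have h := ((hlim 1).comp tendsto_natCast_atTop_atTop).cesaro
    refine h.congr fun n => ?_
    have := Finset.sum_range_sub (fun i : ℕ => g i) n
    simp only [Nat.cast_add, Nat.cast_one, Nat.cast_zero] at this
    simp [this]
  have hnat : Tendsto (fun n : ℕ => g n / n) atTop (𝓝 0) := by
    have h0 : Tendsto (fun n : ℕ => (n : ℝ)⁻¹ * g 0) atTop (𝓝 0) := by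
      simpa using (tendsto_inv_atTop_nhds_zero_nat (𝕜 := ℝ)).mul_const (g 0)
    have := hces.add h0
    rw [add_zero] at this
    refine this.congr fun n => ?_
    ring
  have hfl : Tendsto (fun u : ℝ => g (⌊u⌋₊ : ℝ) / (⌊u⌋₊ : ℝ) * ((⌊u⌋₊ : ℝ) / u)) atTop (𝓝 0) := by
    simpa using (hnat.comp tendsto_nat_floor_atTop).mul (tendsto_nat_floor_div_atTop (R := ℝ))
  have hrem : Tendsto (fun u : ℝ => (g u - g (⌊u⌋₊ : ℝ)) / u) atTop (𝓝 0) := by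
    have hev := (tendsto_natCast_atTop_atTop.comp (tendsto_nat_floor_atTop (α := ℝ))).eventually
      (eventually_forall_abs_sub_lt_of_tendsto_zero hg hlim one_pos)
    refine squeeze_zero_norm' ?_ tendsto_inv_atTop_zero
    filter_upwards [hev, eventually_gt_atTop 0] with u hu hu0
    have h := hu (u - ⌊u⌋₊) ⟨by linarith [Nat.floor_le hu0.le], by linarith [Nat.lt_floor_add_one u]⟩
    simp only [Function.comp_apply, add_sub_cancel] at h
    rw [norm_div, Real.norm_eq_abs, Real.norm_eq_abs, abs_of_pos hu0, inv_eq_one_div]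
    gcongr
  have hsum := hfl.add hrem
  rw [add_zero] at hsum
  refine hsum.congr' ?_
  filter_upwards [eventually_ge_atTop 1] with u hu
  have h1 : (⌊u⌋₊ : ℝ) ≠ 0 := by
    have := (Nat.floor_pos.2 hu).ne'
    exact_mod_cast this
  have h2 : u ≠ 0 := by linarith
  field_simp
  ring

/-- Characterization and growth of regularly varying functions, in additive form. The limit of the
increments is additive and measurable, hence linear. -/
lemma exists_forall_eq_mul_and_tendsto_div_self {h k : ℝ → ℝ} (hh : Measurable h)
    (hlim : ∀ x, Tendsto (fun u => h (u + x) - h u) atTop (𝓝 (k x))) :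
    ∃ ρ : ℝ, (∀ x, k x = ρ * x) ∧ Tendsto (fun u => h u / u) atTop (𝓝 ρ) := by
  have hadd : ∀ x y, k (x + y) = k x + k y := by
    intro x y
    have h1 := ((hlim y).comp (tendsto_atTop_add_const_right atTop x tendsto_id)).add (hlim x)
    rw [add_comm (k x)]
    refine tendsto_nhds_unique (hlim (x + y)) (h1.congr fun u => ?_)
    simp only [Function.comp_apply, id_eq]
    rw [show u + x + y = u + (x + y) by ring]
    ring
  have hk : Measurable k :=
    measurable_of_tendsto_metrizable (f := fun (n : ℕ) x => h (n + x) - h n)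
      (fun n => by fun_prop)
      (tendsto_pi_nhds.2 fun x => (hlim x).comp tendsto_natCast_atTop_atTop)
  let K : ℝ →+ ℝ := AddMonoidHom.mk' k hadd
  have hK : Continuous K := MeasureTheory.Measure.AddMonoidHom.continuous_of_measurable K hk
  have hlin : ∀ x, k x = k 1 * x := by
    intro x
    have := (K.toRealLinearMap hK).map_smul x 1
    simpa [K, mul_comm] using this
  refine ⟨k 1, hlin, ?_⟩
  have hg := tendsto_div_self_zero_of_tendsto_increments_zero (g := fun u => h u - k 1 * u)
    (by fun_prop) fun x => by
      have := (hlim x).sub_const (k x)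
      rw [sub_self] at this
      refine this.congr fun u => ?_
      rw [hlin x]
      ring
  have := hg.add_const (k 1)
  rw [zero_add] at this
  refine this.congr' ?_
  filter_upwards [eventually_ne_atTop 0] with u hu
  field_simp
  ring

/-! ### The Laplace transform of the modulus of a random variable -/

/-- The Laplace transform `r ↦ E exp (-r |ξ|)` of the modulus of a random variable `ξ`. -/
noncomputable def absLaplace {Ω : Type*} [MeasurableSpace Ω] (P : Measure Ω) (ξ : Ω → ℝ) (r : ℝ) :
    ℝ :=
  ∫ ω, Real.exp (-(r * |ξ ω|)) ∂P

section Laplace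

variable {ι Ω Ω' : Type*} [MeasurableSpace Ω] [MeasurableSpace Ω'] {P : Measure Ω}
  [IsProbabilityMeasure P] {P' : Measure Ω'} [IsProbabilityMeasure P'] {ξ : Ω → ℝ}

lemma norm_exp_neg_mul_abs_le_one {r : ℝ} (hr : 0 ≤ r) (y : ℝ) :
    ‖Real.exp (-(r * |y|))‖ ≤ 1 := by
  rw [Real.norm_eq_abs, Real.abs_exp, Real.exp_le_one_iff]
  have := mul_nonneg hr (abs_nonneg y)
  linarith

lemma integrable_exp_neg_mul_abs (hξ : AEMeasurable ξ P) {r : ℝ} (hr : 0 ≤ r) :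
    Integrable (fun ω => Real.exp (-(r * |ξ ω|))) P :=
  Integrable.of_bound (AEMeasurable.aestronglyMeasurable (by fun_prop)) 1
    (ae_of_all _ fun ω => norm_exp_neg_mul_abs_le_one hr (ξ ω))

lemma continuous_absLaplace_exp (hξ : AEMeasurable ξ P) :
    Continuous fun x => absLaplace P ξ (Real.exp x) := by
  refine continuous_of_dominated (bound := fun _ => 1)
    (fun x => (integrable_exp_neg_mul_abs hξ (Real.exp_nonneg x)).aestronglyMeasurable)
    (fun x => ae_of_all _ fun ω => norm_exp_neg_mul_abs_le_one (Real.exp_nonneg x) (ξ ω))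
    (integrable_const 1) (ae_of_all _ fun ω => by fun_prop)

lemma absLaplace_lt_absLaplace (hξ : AEMeasurable ξ P) (h0 : ∀ᵐ ω ∂P, ξ ω ≠ 0) {r s : ℝ}
    (hr : 0 ≤ r) (hrs : r < s) : absLaplace P ξ s < absLaplace P ξ r := by
  have hir := integrable_exp_neg_mul_abs hξ hr
  have his := integrable_exp_neg_mul_abs hξ (hr.trans hrs.le)
  have hpos : ∀ᵐ ω ∂P, 0 < Real.exp (-(r * |ξ ω|)) - Real.exp (-(s * |ξ ω|)) := by
    filter_upwards [h0] with ω hω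
    rw [sub_pos, Real.exp_lt_exp, neg_lt_neg_iff]
    exact mul_lt_mul_of_pos_right hrs (abs_pos.2 hω)
  rw [← sub_pos, absLaplace, absLaplace, ← integral_sub hir his,
    integral_pos_iff_support_of_nonneg_ae (hpos.mono fun ω h => h.le) (hir.sub his)]
  rw [pos_iff_ne_zero]
  intro hz
  obtain ⟨ω, hω, hω'⟩ := (hpos.and (measure_eq_zero_iff_ae_notMem.1 hz)).exists
  exact hω' hω.ne'

lemma strictAnti_absLaplace_exp (hξ : AEMeasurable ξ P) (h0 : ∀ᵐ ω ∂P, ξ ω ≠ 0) :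
    StrictAnti fun x => absLaplace P ξ (Real.exp x) := fun x _ hxy =>
  absLaplace_lt_absLaplace hξ h0 (Real.exp_nonneg x) (Real.exp_lt_exp.2 hxy)

lemma tendsto_absLaplace_exp_atTop (hξ : AEMeasurable ξ P) (h0 : ∀ᵐ ω ∂P, ξ ω ≠ 0) :
    Tendsto (fun x => absLaplace P ξ (Real.exp x)) atTop (𝓝 0) := by
  have h := tendsto_integral_filter_of_dominated_convergence (μ := P) (l := atTop)
    (F := fun x ω => Real.exp (-(Real.exp x * |ξ ω|))) (f := fun _ => 0) (fun _ => 1)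
    (.of_forall fun x =>
      (integrable_exp_neg_mul_abs hξ (Real.exp_nonneg x)).aestronglyMeasurable)
    (.of_forall fun x =>
      ae_of_all _ fun ω => norm_exp_neg_mul_abs_le_one (Real.exp_nonneg x) (ξ ω))
    (integrable_const 1) ?_
  · simpa [absLaplace] using h
  · filter_upwards [h0] with ω hω
    exact Real.tendsto_exp_neg_atTop_nhds_zero.comp
      (Real.tendsto_exp_atTop.atTop_mul_const (abs_pos.2 hω))

lemma absLaplace_zero : absLaplace P ξ 0 = 1 := by simp [absLaplace]

lemma tendsto_absLaplace_exp_atBot (hξ : AEMeasurable ξ P) :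
    Tendsto (fun x => absLaplace P ξ (Real.exp x)) atBot (𝓝 1) := by
  have h := tendsto_integral_filter_of_dominated_convergence (μ := P) (l := atBot)
    (F := fun x ω => Real.exp (-(Real.exp x * |ξ ω|))) (f := fun _ => 1) (fun _ => 1)
    (.of_forall fun x =>
      (integrable_exp_neg_mul_abs hξ (Real.exp_nonneg x)).aestronglyMeasurable)
    (.of_forall fun x =>
      ae_of_all _ fun ω => norm_exp_neg_mul_abs_le_one (Real.exp_nonneg x) (ξ ω))
    (integrable_const 1) (ae_of_all _ fun ω => ?_)
  · simpa [absLaplace] using h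
  · have : Tendsto (fun x => Real.exp (-(Real.exp x * |ξ ω|))) atBot
        (𝓝 (Real.exp (-(0 * |ξ ω|)))) :=
      (Real.continuous_exp.tendsto _).comp (Real.tendsto_exp_atBot.mul_const _).neg
    simpa using this

lemma tendsto_absLaplace {Y : ι → Ω → ℝ} {ζ : Ω' → ℝ} {l : Filter ι}
    (h : TendstoInDistribution Y l ζ (fun _ => P) P') {r : ℝ} (hr : 0 ≤ r) :
    Tendsto (fun i => absLaplace P (Y i) r) l (𝓝 (absLaplace P' ζ r)) := by
  have hc : Continuous fun y : ℝ => Real.exp (-(r * |y|)) := by fun_prop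
  have h1 := ProbabilityMeasure.tendsto_iff_forall_integral_tendsto.1 h.tendsto
    (BoundedContinuousFunction.ofNormedAddCommGroup _ hc 1 (norm_exp_neg_mul_abs_le_one hr))
  simp only [BoundedContinuousFunction.coe_ofNormedAddCommGroup, ProbabilityMeasure.coe_mk] at h1
  rw [integral_map h.aemeasurable_limit hc.aestronglyMeasurable] at h1
  refine h1.congr fun i => ?_
  rw [integral_map (h.forall_aemeasurable i) hc.aestronglyMeasurable, absLaplace]

/-- Convergence of types for moduli: if `Y` and its rescaling `W`, with `|W| = exp d * |Y|`, both
converge in distribution to limits without an atom at zero, then the log-scale `d` converges. Its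
limit `x` solves `absLaplace P' ξ (exp x) = absLaplace P' ζ 1`, and the strict monotonicity of the
Laplace transform squeezes `d` between `x - ε` and `x + ε`. -/
lemma exists_tendsto_log_scale {Y W : ι → Ω → ℝ} {ξ ζ : Ω' → ℝ} {d : ι → ℝ} {l : Filter ι}
    (hY : TendstoInDistribution Y l ξ (fun _ => P) P')
    (hW : TendstoInDistribution W l ζ (fun _ => P) P')
    (hd : ∀ i ω, |W i ω| = Real.exp (d i) * |Y i ω|)
    (hξ0 : ∀ᵐ ω ∂P', ξ ω ≠ 0) (hζ0 : ∀ᵐ ω ∂P', ζ ω ≠ 0) :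
    ∃ x, Tendsto d l (𝓝 x) ∧ absLaplace P' ξ (Real.exp x) = absLaplace P' ζ 1 := by
  have hξ := hY.aemeasurable_limit
  have hζ := hW.aemeasurable_limit
  have hanti := strictAnti_absLaplace_exp hξ hξ0
  have hc1 : absLaplace P' ζ 1 < 1 := by
    simpa [absLaplace_zero] using absLaplace_lt_absLaplace hζ hζ0 le_rfl one_pos
  have hc0 : 0 < absLaplace P' ζ 1 :=
    integral_exp_pos (integrable_exp_neg_mul_abs hζ zero_le_one)
  obtain ⟨x₁, hx₁⟩ := ((tendsto_absLaplace_exp_atTop hξ hξ0).eventually_lt_const hc0).exists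
  obtain ⟨x₂, hx₂⟩ := ((tendsto_absLaplace_exp_atBot hξ).eventually_const_lt hc1).exists
  obtain ⟨x, hx⟩ := mem_range_of_exists_le_of_exists_ge (continuous_absLaplace_exp hξ)
    ⟨x₁, hx₁.le⟩ ⟨x₂, hx₂.le⟩
  refine ⟨x, ?_, hx⟩
  have hWY : ∀ i, absLaplace P (W i) 1 = absLaplace P (Y i) (Real.exp (d i)) := by
    intro i
    simp only [absLaplace, hd, one_mul]
  have hle : ∀ i y z, y ≤ z →
      absLaplace P (Y i) (Real.exp z) ≤ absLaplace P (Y i) (Real.exp y) := by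
    intro i y z hyz
    refine integral_mono (integrable_exp_neg_mul_abs (hY.forall_aemeasurable i) (Real.exp_nonneg _))
      (integrable_exp_neg_mul_abs (hY.forall_aemeasurable i) (Real.exp_nonneg _)) fun ω => ?_
    dsimp only
    gcongr
  have hlimW := tendsto_absLaplace hW zero_le_one
  rw [← hx] at hlimW
  rw [tendsto_order]
  constructor
  · intro y hy
    filter_upwards [hlimW.eventually_lt (tendsto_absLaplace hY (Real.exp_nonneg y)) (hanti hy)]
      with i hi
    by_contra! hcon
    rw [hWY] at hi
    exact absurd hi (not_lt.2 (hle i _ _ hcon))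
  · intro y hy
    filter_upwards [(tendsto_absLaplace hY (Real.exp_nonneg y)).eventually_lt hlimW (hanti hy)]
      with i hi
    by_contra! hcon
    rw [hWY] at hi
    exact absurd hi (not_lt.2 (hle i _ _ hcon))

/-- If `Y` converges in distribution to a limit without an atom at zero, then `log |Y|` is tight, so
`log (exp b * |Y|)` is governed by `b` on any scale `L` that tends to infinity. -/
lemma tendstoInMeasure_log_abs_div {Y X : ι → Ω → ℝ} {ζ : Ω' → ℝ} {b L : ι → ℝ} {H : ℝ}
    {l : Filter ι} (hY : TendstoInDistribution Y l ζ (fun _ => P) P')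
    (hζ0 : ∀ᵐ ω ∂P', ζ ω ≠ 0) (hX : ∀ᶠ i in l, ∀ ω, |X i ω| = Real.exp (b i) * |Y i ω|)
    (hL : Tendsto L l atTop) (hb : Tendsto (fun i => b i / L i) l (𝓝 H)) :
    TendstoInMeasure P (fun i ω => Real.log |X i ω| / L i) l (fun _ => H) := by
  have hζ := hY.aemeasurable_limit
  -- The closed sets of values whose modulus is outside `(exp (-n), exp n)` shrink to `{0}`.
  let F : ℕ → Set ℝ := fun n => {y | |y| ≤ Real.exp (-n) ∨ Real.exp n ≤ |y|}
  have hF : ∀ n, IsClosed (F n) := fun n =>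
    (isClosed_le continuous_abs continuous_const).union
      (isClosed_le continuous_const continuous_abs)
  have hFanti : Antitone F := by
    intro m n hmn y hy
    have hmn' : (m : ℝ) ≤ n := by exact_mod_cast hmn
    rcases hy with hy | hy
    · exact Or.inl (hy.trans (Real.exp_le_exp.2 (neg_le_neg hmn')))
    · exact Or.inr ((Real.exp_le_exp.2 hmn').trans hy)
  have hFinter : ⋂ n, F n = {0} := by
    ext y
    simp only [Set.mem_iInter, Set.mem_singleton_iff]
    constructor
    · intro h
      by_contra hy
      obtain ⟨n, hn⟩ := exists_nat_gt |Real.log (|y|)|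
      rw [abs_lt] at hn
      have hpos := abs_pos.2 hy
      rcases h n with h | h
      · have := (Real.log_le_iff_le_exp hpos).2 h
        linarith [hn.1]
      · have := (Real.le_log_iff_exp_le hpos).2 h
        linarith [hn.2]
    · rintro rfl n
      exact Or.inl (by simpa using Real.exp_nonneg _)
  have hlimF : Tendsto (fun n => P'.map ζ (F n)) atTop (𝓝 0) := by
    have := Measure.isProbabilityMeasure_map hζ
    have h := tendsto_measure_iInter_atTop (μ := P'.map ζ) (s := F)
      (fun n => (hF n).measurableSet.nullMeasurableSet) hFanti ⟨0, measure_ne_top _ _⟩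
    rw [hFinter, Measure.map_apply_of_aemeasurable hζ (measurableSet_singleton 0)] at h
    have h0 : P' (ζ ⁻¹' {0}) = 0 := by simpa [ae_iff, Set.preimage] using hζ0
    rwa [h0] at h
  rw [tendstoInMeasure_iff_norm]
  intro ε hε
  rw [ENNReal.tendsto_nhds_zero]
  intro η hη
  obtain ⟨n, hn⟩ := (hlimF.eventually_lt_const hη).exists
  have hlimsup := ProbabilityMeasure.limsup_measure_closed_le_of_tendsto hY.tendsto (hF n)
  have hev := eventually_lt_of_limsup_lt (hlimsup.trans_lt hn)
  have hsmall : ∀ᶠ i in l, (n : ℝ) / L i < ε / 2 :=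
    (tendsto_const_nhds.div_atTop hL).eventually_lt_const (half_pos hε)
  have hbH : ∀ᶠ i in l, |b i / L i - H| < ε / 2 := by
    simpa [Real.dist_eq] using Metric.tendsto_nhds.1 hb (ε / 2) (half_pos hε)
  filter_upwards [hev, hsmall, hbH, hX, hL.eventually_gt_atTop 0] with i hi hsi hbi hXi hLi
  rw [ProbabilityMeasure.coe_mk,
    Measure.map_apply_of_aemeasurable (hY.forall_aemeasurable i) (hF n).measurableSet] at hi
  refine (measure_mono fun ω hω => ?_).trans hi.le
  -- Outside `F n` the value `Y i ω` is nonzero, so `log |X i ω|` splits into `b i + log |Y i ω|`.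
  by_contra hcon
  simp only [F, Set.mem_preimage, Set.mem_ofPred_eq, not_or, not_le] at hcon
  have hpos : 0 < |Y i ω| := (Real.exp_pos _).trans hcon.1
  have h1 : -(n : ℝ) < Real.log |Y i ω| := (Real.lt_log_iff_exp_lt hpos).2 hcon.1
  have h2 : Real.log |Y i ω| < n := (Real.log_lt_iff_lt_exp hpos).2 hcon.2
  have h3 : |Real.log |Y i ω| / L i| < ε / 2 := by
    rw [abs_div, abs_of_pos hLi]
    exact (div_le_div_of_nonneg_right (abs_lt.2 ⟨h1, h2⟩).le hLi.le).trans_lt hsi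
  have h4 : Real.log |X i ω| / L i - H = (b i / L i - H) + Real.log |Y i ω| / L i := by
    rw [hXi, Real.log_mul (Real.exp_pos _).ne' hpos.ne', Real.log_exp]
    ring
  simp only [Set.mem_ofPred_eq, h4, Real.norm_eq_abs] at hω
  linarith [abs_add_le (b i / L i - H) (Real.log |Y i ω| / L i)]

end Laplace

/-! ### The scaling limit theorem -/

/-- One-dimensional marginals of a limit of all finite-dimensional distributions. -/
lemma FddTendsto.tendstoInDistribution {ι S Ω Ω' : Type*} [MeasurableSpace Ω] [MeasurableSpace Ω']
    {Y : ι → S → Ω → ℝ} {l : Filter ι} {Z : S → Ω' → ℝ} {P : Measure Ω} [IsProbabilityMeasure P]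
    {P' : Measure Ω'} [IsProbabilityMeasure P'] (h : FddTendsto Y l Z P P') (s : S) :
    TendstoInDistribution (fun i => Y i s) l (Z s) (fun _ => P) P' :=
  (h {s}).continuous_comp (g := fun v : ({s} : Finset S) → ℝ => v ⟨s, Finset.mem_singleton_self s⟩)
    (by fun_prop)

lemma MeasureTheory.TendstoInDistribution.comp_tendsto {ι κ Ω Ω' : Type*} [MeasurableSpace Ω]
    [MeasurableSpace Ω'] {Y : ι → Ω → ℝ} {l : Filter ι} {m : Filter κ} {ζ : Ω' → ℝ} {P : Measure Ω}
    [IsProbabilityMeasure P] {P' : Measure Ω'} [IsProbabilityMeasure P']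
    (h : TendstoInDistribution Y l ζ (fun _ => P) P') {φ : κ → ι} (hφ : Tendsto φ m l) :
    TendstoInDistribution (fun j => Y (φ j)) m ζ (fun _ => P) P' where
  forall_aemeasurable j := h.forall_aemeasurable (φ j)
  aemeasurable_limit := h.aemeasurable_limit
  tendsto := h.tendsto.comp hφ

/-- A scaling limit under a norming that tends to infinity starts at zero, in the sense that the
Laplace transform of `|Z 0|` equals one. -/
lemma absLaplace_limit_zero {Ω Ω' : Type*} [MeasurableSpace Ω] [MeasurableSpace Ω']
    {P : Measure Ω} [IsProbabilityMeasure P] {P' : Measure Ω'} [IsProbabilityMeasure P']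
    {ξ : Ω → ℝ} {ζ : Ω' → ℝ} {a : ℝ≥0 → ℝ} (ha : Tendsto a atTop atTop)
    (h : TendstoInDistribution (fun (T : ℝ≥0) ω => ξ ω / a T) atTop ζ (fun _ => P) P') :
    absLaplace P' ζ 1 = 1 := by
  refine tendsto_nhds_unique (tendsto_absLaplace h zero_le_one) ?_
  have hdom := tendsto_integral_filter_of_dominated_convergence (μ := P) (l := atTop)
    (F := fun (T : ℝ≥0) ω => Real.exp (-(1 * |ξ ω / a T|))) (f := fun _ => 1) (fun _ => 1)
    (.of_forall fun T =>
      (integrable_exp_neg_mul_abs (h.forall_aemeasurable T) zero_le_one).aestronglyMeasurable)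
    (.of_forall fun T => ae_of_all _ fun ω => norm_exp_neg_mul_abs_le_one zero_le_one _)
    (integrable_const 1) (ae_of_all _ fun ω => ?_)
  · simpa [absLaplace] using hdom
  · have hc : Continuous fun y : ℝ => Real.exp (-(1 * |y|)) := by fun_prop
    have := (hc.tendsto 0).comp ((tendsto_const_nhds (x := ξ ω)).div_atTop ha)
    simpa [Function.comp_def] using this

theorem mainTheorem5 {Ω Ω' : Type*} [MeasurableSpace Ω] [MeasurableSpace Ω']
    (P : Measure Ω) [IsProbabilityMeasure P] (P' : Measure Ω') [IsProbabilityMeasure P']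
    (X : ℝ≥0 → Ω → ℝ) (Z : ℝ≥0 → Ω' → ℝ) (a : ℝ≥0 → ℝ)
    (ha_meas : Measurable a) (ha_pos : ∀ T : ℝ≥0, 0 < T → 0 < a T)
    (ha_top : Tendsto a atTop atTop)
    (hZ_nondeg : ∀ t : ℝ≥0, 0 < t → IsNondegenerate (Z t) P')
    (hZ_zero : ∀ t : ℝ≥0, 0 < t → ∀ᵐ ω ∂P', Z t ω ≠ 0)
    (hZ_cont : TendstoInMeasure P' Z (𝓝 0) (Z 0))
    (hlim : FddTendsto (fun (T t : ℝ≥0) (ω : Ω) => X (T * t) ω / a T) atTop Z P P') :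
    ∃ H : ℝ, 0 < H ∧ ∀ t : ℝ≥0, 0 < t →
      TendstoInMeasure P
        (fun (T : ℝ≥0) (ω : Ω) => Real.log |X (T * t) ω| / Real.log (T : ℝ)) atTop
        (fun _ => H) := by
  let e : ℝ → ℝ≥0 := fun u => (Real.exp u).toNNReal
  have he_pos : ∀ u, 0 < e u := fun u => Real.toNNReal_pos.2 (Real.exp_pos u)
  have he_add : ∀ u x, e (u + x) = e u * e x := fun u x => by
    simp only [e, Real.exp_add, Real.toNNReal_mul (Real.exp_nonneg u)]
  have he_top : Tendsto e atTop atTop := Real.tendsto_toNNReal_atTop.comp Real.tendsto_exp_atTop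
  have he_meas : Measurable e := by fun_prop
  have hmarg := fun t => hlim.tendstoInDistribution t
  let h : ℝ → ℝ := fun u => Real.log (a (e u))
  have hh : Measurable h := by fun_prop
  -- Compare the two normings `a (e u)` and `a (e (u + x))` of `X (e (u + x))`.
  have htypes : ∀ x, ∃ y, Tendsto (fun u => h (u + x) - h u) atTop (𝓝 y) ∧
      absLaplace P' (Z 1) (Real.exp y) = absLaplace P' (Z (e x)) 1 := by
    intro x
    refine exists_tendsto_log_scale
      ((hmarg 1).comp_tendsto (he_top.comp (tendsto_atTop_add_const_right atTop x tendsto_id)))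
      ((hmarg (e x)).comp_tendsto he_top) (fun u ω => ?_) (hZ_zero 1 one_pos)
      (hZ_zero _ (he_pos x))
    have h1 := ha_pos _ (he_pos u)
    have h2 := ha_pos _ (he_pos (u + x))
    simp only [h, Function.comp_apply, id_eq, mul_one, Real.exp_sub, Real.exp_log h1,
      Real.exp_log h2, ← he_add, abs_div, abs_of_pos h1, abs_of_pos h2]
    field_simp
  choose k hk hkL using htypes
  obtain ⟨ρ, hρ, hgrowth⟩ := exists_forall_eq_mul_and_tendsto_div_self hh hk
  have hZ_meas : ∀ t, AEMeasurable (Z t) P' := fun t => (hmarg t).aemeasurable_limit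
  refine ⟨ρ, ?_, fun t ht => ?_⟩
  · -- For `ρ ≤ 0` the law of `|Z s|` stays away from zero as `s → 0`.
    by_contra! hneg
    have he_bot : Tendsto e atBot (𝓝 0) := by
      have := (continuous_real_toNNReal.tendsto 0).comp Real.tendsto_exp_atBot
      rwa [Real.toNNReal_zero] at this
    have hZ0 := (tendsto_absLaplace (hZ_cont.tendstoInDistribution hZ_meas) zero_le_one).comp he_bot
    rw [absLaplace_limit_zero ha_top (by simpa using hmarg 0)] at hZ0
    have hanti := strictAnti_absLaplace_exp (hZ_meas 1) (hZ_zero 1 one_pos)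
    have hle : 1 ≤ absLaplace P' (Z 1) (Real.exp 0) := by
      refine le_of_tendsto hZ0 ?_
      filter_upwards [eventually_le_atBot 0] with x hx
      rw [Function.comp_apply, ← hkL x, hρ x]
      exact hanti.antitone (mul_nonneg_of_nonpos_of_nonpos hneg hx)
    have hlt := absLaplace_lt_absLaplace (hZ_meas 1) (hZ_zero 1 one_pos) le_rfl (Real.exp_pos 0)
    rw [absLaplace_zero] at hlt
    exact absurd hle (not_le.2 hlt)
  · have hlog : Tendsto (fun T : ℝ≥0 => Real.log (T : ℝ)) atTop atTop :=
      Real.tendsto_log_atTop.comp (NNReal.tendsto_coe_atTop.2 tendsto_id)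
    refine tendstoInMeasure_log_abs_div (b := fun T => Real.log (a T)) (hmarg t) (hZ_zero t ht) ?_
      hlog ?_
    · filter_upwards [eventually_gt_atTop 0] with T hT ω
      have := ha_pos T hT
      rw [Real.exp_log this, abs_div, abs_of_pos this]
      field_simp
    · refine (hgrowth.comp hlog).congr' ?_
      filter_upwards [eventually_gt_atTop 0] with T hT
      have hT' : (0 : ℝ) < T := hT
      simp only [Function.comp_apply, h, e, Real.exp_log hT', Real.toNNReal_coe]
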